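/- Consider an energy storage with maximum power $P^{\max}\ge 0$, period length $\tau>0$, charging and discharging efficiencies $\eta^c,\eta^d\in(0,1]$, and energy bounds $\underline E,\overline E$. Let the combined prices $\gamma_1,\gamma_2,\dots$ be independent and identically distributed real random variables with $\gamma_t\in[\underline\gamma,\overline\gamma]$ almost surely, where $0\le\underline\gamma<\overline\gamma\,\eta^c\eta^d$. Let $V$ and $E$ satisfy $$0<V\le\frac{\eta^c(\overline E-\underline E)}{\overline\gamma\eta^c\eta^d-\underline\gamma},\qquad \underline E+V\overline\gamma\,\eta^d\le E\le\overline E+V\underline\gamma/\eta^c .$$ *Offline problem.* A feasible solution consists of random variables $p^c_t,p^d_t,e_t$ ($t\ge1$; they may depend on the prices of all periods, and $e_1$ is also free) such that almost surely, for all $t$, $0\le p^c_t,p^d_t\le P^{\max}$, $p^c_tp^d_t=0$, $e_{t+1}=e_t+p^c_t\tau\eta^c-p^d_t\tau/\eta^d$ and $\underline E\le e_t\le\overline E$. Let $v_0^*$ be the supremum, over the feasible solutions for which the limit exists, of $\lim_{T\to\infty}\frac1T\sum_{t=1}^T\mathbb E[\gamma_t(p^d_t-p^c_t)\tau]$. *Online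 strategy.* Start from an initial energy $e_1\in[\underline E,\overline E]$ (a constant, or a random variable independent of the prices). In period $t$ put $q_t=e_t-E$, and let the net output $p_t$ be - $-P^{\max}$ if $q_t\le-\frac{V\gamma_t}{\eta^c}-P^{\max}\tau\eta^c$, - $\frac{q_t\eta^c+V\gamma_t}{\tau(\eta^c)^2}$ if $-\frac{V\gamma_t}{\eta^c}-P^{\max}\tau\eta^c\le q_t\le-\frac{V\gamma_t}{\eta^c}$, - $0$ if $-\frac{V\gamma_t}{\eta^c}\le q_t\le-V\gamma_t\eta^d$, - $\frac{q_t/\eta^d+V\gamma_t}{\tau/(\eta^d)^2}$ if $-V\gamma_t\eta^d\le q_t\le-V\gamma_t\eta^d+\frac{P^{\max}\tau}{\eta^d}$, - $P^{\max}$ if $-V\gamma_t\eta^d+\frac{P^{\max}\tau}{\eta^d}\le q_t$. Put $p^c_t=\max(-p_t,0)$, $p^d_t=\max(p_t,0)$ and $e_{t+1}=e_t+p^c_t\tau\eta^c-p^d_t\tau/\eta^d$. Then, for every real $q_t$ and every $\gamma_t\in[\underline\gamma,\overline\gamma]$, the pair $(p^c_t,p^d_t)$ is the unique minimizer of the drift-plus-penalty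 term $$\tfrac12\bigl(p^c\tau\eta^c-p^d\tau/\eta^d\bigr)^2+\bigl(p^c\tau\eta^c-p^d\tau/\eta^d\bigr)q_t-V\gamma_t(p^d-p^c)\tau$$ over $0\le p^c,p^d\le P^{\max}$, $p^cp^d=0$. Moreover $v_0^*$ is finite, the time-average expected revenue of the online strategy, $v^*=\lim_{T\to\infty}\frac1T\sum_{t=1}^T\mathbb E[\gamma_tp_t\tau]$, exists, and $$v_0^*-\frac{(P^{\max}\tau)^2}{2V(\eta^d)^2}\le v^*\le v_0^*.$$ -/

import Mathlib

open Filter Topology MeasureTheory ProbabilityTheory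

/-- The technical data of an energy storage: maximum (dis)charging power, period length,
charging and discharging efficiencies, lower and upper bounds of the stored energy. -/
structure Storage where
  Pmax : ℝ
  τ : ℝ
  ηc : ℝ
  ηd : ℝ
  Emin : ℝ
  Emax : ℝ

namespace Storage

/-- Admissible pairs of charging power `c` and discharging power `d` in one period. -/
def PowerFeasible (S : Storage) (c d : ℝ) : Prop :=
  (0 ≤ c ∧ c ≤ S.Pmax) ∧ (0 ≤ d ∧ d ≤ S.Pmax) ∧ c * d = 0

/-- Change of the stored energy in one period. -/
noncomputable def change (S : Storage) (c d : ℝ) : ℝ :=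
  c * S.τ * S.ηc - d * S.τ / S.ηd

/-- The exact one-period drift-plus-penalty term at virtual queue `q` and combined price `g`. -/
noncomputable def driftPlusPenalty (S : Storage) (V q g c d : ℝ) : ℝ :=
  ((S.change c d) ^ 2 / 2 + S.change c d * q) + V * (-(g * (d - c) * S.τ))

/-- `(c, d)` is an optimal solution of the one-period drift-plus-penalty problem. -/
def IsDriftPlusPenaltyOptimal (S : Storage) (V q g c d : ℝ) : Prop :=
  S.PowerFeasible c d ∧
    ∀ c' d' : ℝ, S.PowerFeasible c' d' →
      S.driftPlusPenalty V q g c d ≤ S.driftPlusPenalty V q g c' d'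

/-- The online strategy: net output as a piecewise linear function of the
virtual queue `q` and the combined price `g`. -/
noncomputable def netOutput (S : Storage) (V q g : ℝ) : ℝ :=
  if q ≤ -(V * g / S.ηc) - S.Pmax * S.τ * S.ηc then -S.Pmax
  else if q ≤ -(V * g / S.ηc) then (q * S.ηc + V * g) / (S.τ * S.ηc ^ 2)
  else if q ≤ -(V * g * S.ηd) then 0
  else if q ≤ -(V * g * S.ηd) + S.Pmax * S.τ / S.ηd then
    (q / S.ηd + V * g) / (S.τ / S.ηd ^ 2)
  else S.Pmax

/-- Charging power of the online strategy. -/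
noncomputable def onlineCharge (S : Storage) (V q g : ℝ) : ℝ := max (-(S.netOutput V q g)) 0

/-- Discharging power of the online strategy. -/
noncomputable def onlineDischarge (S : Storage) (V q g : ℝ) : ℝ := max (S.netOutput V q g) 0

/-- Stored energy at the beginning of period `t` (periods are numbered from `0`) under the online
strategy with penalty coefficient `V` and shift `E`, started at `e₀`; the virtual queue is the
stored energy minus `E`. -/
noncomputable def onlineEnergy {Ω : Type*} (S : Storage) (V E : ℝ) (e₀ : Ω → ℝ)
    (γ : ℕ → Ω → ℝ) : ℕ → Ω → ℝ
  | 0 => e₀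
  | t + 1 => fun ω =>
      S.onlineEnergy V E e₀ γ t ω +
        S.change (S.onlineCharge V (S.onlineEnergy V E e₀ γ t ω - E) (γ t ω))
          (S.onlineDischarge V (S.onlineEnergy V E e₀ γ t ω - E) (γ t ω))

/-- Average over the first `T` periods of the expected revenue of the charging and discharging
processes `pc`, `pd`. -/
noncomputable def avgRevenue {Ω : Type*} [MeasurableSpace Ω] (S : Storage) (μ : Measure Ω)
    (γ pc pd : ℕ → Ω → ℝ) (T : ℕ) : ℝ :=
  (1 / (T : ℝ)) * ∑ t ∈ Finset.range T, ∫ ω, γ t ω * (pd t ω - pc t ω) * S.τ ∂μ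

/-- Average over the first `T` periods of the expected revenue of the online strategy. -/
noncomputable def onlineAvgRevenue {Ω : Type*} [MeasurableSpace Ω] (S : Storage) (μ : Measure Ω)
    (V E : ℝ) (e₀ : Ω → ℝ) (γ : ℕ → Ω → ℝ) (T : ℕ) : ℝ :=
  S.avgRevenue μ γ
    (fun t ω => S.onlineCharge V (S.onlineEnergy V E e₀ γ t ω - E) (γ t ω))
    (fun t ω => S.onlineDischarge V (S.onlineEnergy V E e₀ γ t ω - E) (γ t ω)) T

/-- Feasibility of random decision processes for the offline problem. No causality is imposed:
decisions may depend on the prices of all periods. The initial energy is a decision, too. -/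
structure IsOfflineFeasible {Ω : Type*} [MeasurableSpace Ω] (S : Storage) (μ : Measure Ω)
    (pc pd e : ℕ → Ω → ℝ) : Prop where
  measurable_pc : ∀ t, Measurable (pc t)
  measurable_pd : ∀ t, Measurable (pd t)
  measurable_e : ∀ t, Measurable (e t)
  power : ∀ᵐ ω ∂μ, ∀ t, S.PowerFeasible (pc t ω) (pd t ω)
  dynamics : ∀ᵐ ω ∂μ, ∀ t, e (t + 1) ω = e t ω + S.change (pc t ω) (pd t ω)
  range : ∀ᵐ ω ∂μ, ∀ t, S.Emin ≤ e t ω ∧ e t ω ≤ S.Emax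

/-- The long-run average expected revenues of the feasible solutions of the offline problem. -/
def offlineValues {Ω : Type*} [MeasurableSpace Ω] (S : Storage) (μ : Measure Ω)
    (γ : ℕ → Ω → ℝ) : Set ℝ :=
  {v | ∃ pc pd e : ℕ → Ω → ℝ, S.IsOfflineFeasible μ pc pd e ∧
    Tendsto (S.avgRevenue μ γ pc pd) atTop (𝓝 v)}

end Storage

/-! In the energy coordinates x = c τ ηc and y = d τ / ηd the one-period objective is (x - y)² / 2 +
a x - b y with a = q + V g / ηc and b = q + V g ηd, where b ≤ a. Its minimizer clamps -a and b to
the admissible ranges, and any other choice costs at least half the squared difference of the energy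
changes (`driftPlusPenalty_online_add_le`). This gives uniqueness and all comparisons below.

The long-run average exists by a coupling: two queues driven by the same prices stay ordered, and
the revenue lead of the higher one is paid for by a shrinking gap (`cumRevenue_coupling`). The
starting point thus changes the total revenue by at most a constant K. Restarting at time m makes
the expected revenue plus K subadditive, and Fekete's lemma applies (`exists_tendsto_cumRevenue`).

For the lower bound, take any offline value w and freeze the queue at a constant q. Comparing
pointwise with the offline decisions, averaging over time and telescoping the bounded energy shows
that the expected optimal penalty at q is at most B - V w, with B = (Pmax τ / ηd)² / 2
(`integral_onlinePenalty_le`). No stationary optimal policy is needed. As the online queue is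
independent of the current price, the same bound holds along it, and telescoping squares gives w - B
/ V ≤ v. The upper bound holds because the online strategy is itself offline feasible. -/

/-! ### The one-period problem and its unique minimizer. -/

/-- The first order optimality condition of the two-sided clamp. -/
theorem clamp_variational {a b X Y x y : ℝ} (hba : b ≤ a)
    (hx : 0 ≤ x) (hxX : x ≤ X) (hy : 0 ≤ y) (hyY : y ≤ Y) :
    0 ≤ (max 0 (min X (-a)) - max 0 (min Y b) + a) * (x - max 0 (min X (-a))) -
      (max 0 (min X (-a)) - max 0 (min Y b) + b) * (y - max 0 (min Y b)) := by
  have hX := hx.trans hxX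
  have hY := hy.trans hyY
  -- Since b ≤ a, at most one clamp is nonzero: a ≤ 0 kills the discharging one, a ≥ 0 the charging
  -- one.
  rcases le_total a 0 with ha | ha
  · have hb : b ≤ 0 := hba.trans ha
    rw [max_eq_left ((min_le_right _ _).trans hb)]
    rcases le_total X (-a) with h | h
    · rw [min_eq_left h, max_eq_right hX]; nlinarith
    · rw [min_eq_right h, max_eq_right (by linarith)]; nlinarith
  · rw [max_eq_left ((min_le_right X (-a)).trans (by linarith))]
    rcases le_total b 0 with hb | hb
    · rw [max_eq_left ((min_le_right Y b).trans hb)]; nlinarith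
    · rcases le_total Y b with h | h
      · rw [min_eq_left h, max_eq_right hY]; nlinarith
      · rw [min_eq_right h, max_eq_right hb]; nlinarith

namespace Storage

/-- The standing assumptions on the technical data of a storage. -/
structure IsRegular (S : Storage) : Prop where
  Pmax_nonneg : 0 ≤ S.Pmax
  τ_pos : 0 < S.τ
  ηc_pos : 0 < S.ηc
  ηc_le : S.ηc ≤ 1
  ηd_pos : 0 < S.ηd
  ηd_le : S.ηd ≤ 1

variable {S : Storage}

namespace IsRegular

theorem threshold_le (hS : S.IsRegular) {V g : ℝ} (hVg : 0 ≤ V * g) :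
    V * g * S.ηd ≤ V * g / S.ηc := by
  have h1 := hS.ηc_pos
  rw [le_div_iff₀ h1]
  have h2 : S.ηd * S.ηc ≤ 1 := mul_le_one₀ hS.ηd_le h1.le hS.ηc_le
  nlinarith

theorem maxCharge_nonneg (hS : S.IsRegular) : 0 ≤ S.Pmax * S.τ * S.ηc :=
  mul_nonneg (mul_nonneg hS.Pmax_nonneg hS.τ_pos.le) hS.ηc_pos.le

theorem maxDischarge_nonneg (hS : S.IsRegular) : 0 ≤ S.Pmax * S.τ / S.ηd :=
  div_nonneg (mul_nonneg hS.Pmax_nonneg hS.τ_pos.le) hS.ηd_pos.le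

theorem maxCharge_le_maxDischarge (hS : S.IsRegular) :
    S.Pmax * S.τ * S.ηc ≤ S.Pmax * S.τ / S.ηd := by
  have h := mul_nonneg hS.Pmax_nonneg hS.τ_pos.le
  calc S.Pmax * S.τ * S.ηc ≤ S.Pmax * S.τ := mul_le_of_le_one_right h hS.ηc_le
    _ ≤ S.Pmax * S.τ / S.ηd := le_div_self h hS.ηd_pos hS.ηd_le

/-- The five branches collapse to a clamp; later arguments use this form and its discharging
counterpart. -/
theorem onlineCharge_mul (hS : S.IsRegular) {V g : ℝ} (hVg : 0 ≤ V * g) (q : ℝ) :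
    S.onlineCharge V q g * S.τ * S.ηc =
      max 0 (min (S.Pmax * S.τ * S.ηc) (-(q + V * g / S.ηc))) := by
  have hP := hS.Pmax_nonneg
  have hτ := hS.τ_pos
  have hc := hS.ηc_pos
  have hd := hS.ηd_pos
  have hth := hS.threshold_le hVg
  have hX := hS.maxCharge_nonneg
  unfold onlineCharge netOutput
  split_ifs with h1 h2 h3 h4
  · rw [neg_neg, max_eq_left hP, min_eq_left (by linarith), max_eq_right hX]
  · have hn : (q * S.ηc + V * g) / (S.τ * S.ηc ^ 2) =
        (q + V * g / S.ηc) / (S.τ * S.ηc) := by field_simp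
    have h0 : 0 ≤ -((q + V * g / S.ηc) / (S.τ * S.ηc)) := by
      rw [← neg_div]; exact div_nonneg (by linarith) (by positivity)
    rw [hn, max_eq_left h0, min_eq_right (by linarith), max_eq_right (by linarith)]
    field_simp
  · rw [neg_zero, max_self, max_eq_left ((min_le_right _ _).trans (by linarith))]; simp
  · have h0 : 0 ≤ (q / S.ηd + V * g) / (S.τ / S.ηd ^ 2) := by
      have : q / S.ηd + V * g = (q + V * g * S.ηd) / S.ηd := by field_simp
      rw [this]
      exact div_nonneg (div_nonneg (by linarith) hd.le) (by positivity)
    rw [max_eq_right (by linarith), max_eq_left ((min_le_right _ _).trans (by linarith))]; simp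
  · rw [max_eq_right (by linarith), max_eq_left ((min_le_right _ _).trans (by linarith))]; simp

theorem onlineDischarge_mul (hS : S.IsRegular) {V g : ℝ} (hVg : 0 ≤ V * g) (q : ℝ) :
    S.onlineDischarge V q g * S.τ / S.ηd =
      max 0 (min (S.Pmax * S.τ / S.ηd) (q + V * g * S.ηd)) := by
  have hP := hS.Pmax_nonneg
  have hτ := hS.τ_pos
  have hc := hS.ηc_pos
  have hd := hS.ηd_pos
  have hth := hS.threshold_le hVg
  have hX := hS.maxCharge_nonneg
  have hY := hS.maxDischarge_nonneg
  unfold onlineDischarge netOutput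
  split_ifs with h1 h2 h3 h4
  · rw [max_eq_right (by linarith), max_eq_left ((min_le_right _ _).trans (by linarith))]; simp
  · have hn : (q * S.ηc + V * g) / (S.τ * S.ηc ^ 2) =
        (q + V * g / S.ηc) / (S.τ * S.ηc) := by field_simp
    have h0 : (q + V * g / S.ηc) / (S.τ * S.ηc) ≤ 0 :=
      div_nonpos_of_nonpos_of_nonneg (by linarith) (by positivity)
    rw [hn, max_eq_right h0, max_eq_left ((min_le_right _ _).trans (by linarith))]; simp
  · rw [max_self, max_eq_left ((min_le_right _ _).trans (by linarith))]; simp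
  · have hn : (q / S.ηd + V * g) / (S.τ / S.ηd ^ 2) = (q + V * g * S.ηd) * S.ηd / S.τ := by
      field_simp
    have h0 : 0 ≤ (q + V * g * S.ηd) * S.ηd / S.τ :=
      div_nonneg (mul_nonneg (by linarith) hd.le) hτ.le
    rw [hn, max_eq_left h0, min_eq_right (by linarith), max_eq_right (by linarith)]
    field_simp
  · rw [max_eq_left hP, min_eq_left (by linarith), max_eq_right hY]

end IsRegular

theorem onlineDischarge_sub_onlineCharge (V q g : ℝ) :
    S.onlineDischarge V q g - S.onlineCharge V q g = S.netOutput V q g := by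
  unfold onlineDischarge onlineCharge
  rcases le_total 0 (S.netOutput V q g) with h | h
  · rw [max_eq_left h, max_eq_right (by linarith), sub_zero]
  · rw [max_eq_right h, max_eq_left (by linarith)]; ring

/-- Change of the stored energy in one period under the online strategy. -/
noncomputable def onlineChange (S : Storage) (V q g : ℝ) : ℝ :=
  S.change (S.onlineCharge V q g) (S.onlineDischarge V q g)

namespace IsRegular

theorem onlineChange_eq (hS : S.IsRegular) {V g : ℝ} (hVg : 0 ≤ V * g) (q : ℝ) :
    S.onlineChange V q g = max 0 (min (S.Pmax * S.τ * S.ηc) (-(q + V * g / S.ηc))) -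
      max 0 (min (S.Pmax * S.τ / S.ηd) (q + V * g * S.ηd)) := by
  rw [onlineChange, change, hS.onlineCharge_mul hVg, hS.onlineDischarge_mul hVg]

theorem powerFeasible_online (hS : S.IsRegular) {V g : ℝ} (hVg : 0 ≤ V * g) (q : ℝ) :
    S.PowerFeasible (S.onlineCharge V q g) (S.onlineDischarge V q g) := by
  have hτ := hS.τ_pos
  have hc := hS.ηc_pos
  have hd := hS.ηd_pos
  refine ⟨⟨le_max_right _ _, ?_⟩, ⟨le_max_right _ _, ?_⟩, ?_⟩
  · have h : S.onlineCharge V q g * (S.τ * S.ηc) ≤ S.Pmax * (S.τ * S.ηc) := by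
      rw [← mul_assoc, hS.onlineCharge_mul hVg, ← mul_assoc]
      exact max_le hS.maxCharge_nonneg (min_le_left _ _)
    exact le_of_mul_le_mul_right h (by positivity)
  · have h : S.onlineDischarge V q g * (S.τ / S.ηd) ≤ S.Pmax * (S.τ / S.ηd) := by
      rw [← mul_div_assoc, hS.onlineDischarge_mul hVg, ← mul_div_assoc]
      exact max_le hS.maxDischarge_nonneg (min_le_left _ _)
    exact le_of_mul_le_mul_right h (by positivity)
  · unfold onlineCharge onlineDischarge
    rcases le_total 0 (S.netOutput V q g) with h | h
    · rw [max_eq_right (by linarith : -S.netOutput V q g ≤ 0), zero_mul]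
    · rw [max_eq_right h, mul_zero]

/-- The objective is quadratic in the energy change alone, so expanding at the minimizer leaves the
first order term, nonnegative by `clamp_variational`, plus exactly half the squared difference. -/
theorem driftPlusPenalty_online_add_le (hS : S.IsRegular) {V g : ℝ} (hVg : 0 ≤ V * g) (q : ℝ)
    {c d : ℝ} (hcd : S.PowerFeasible c d) :
    S.driftPlusPenalty V q g (S.onlineCharge V q g) (S.onlineDischarge V q g) +
      (S.change c d - S.onlineChange V q g) ^ 2 / 2 ≤ S.driftPlusPenalty V q g c d := by
  have hτ := hS.τ_pos
  have hc := hS.ηc_pos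
  have hd := hS.ηd_pos
  obtain ⟨⟨hc0, hcP⟩, ⟨hd0, hdP⟩, -⟩ := hcd
  have key : ∀ c d : ℝ, S.driftPlusPenalty V q g c d =
      (c * S.τ * S.ηc - d * S.τ / S.ηd) ^ 2 / 2 + (q + V * g / S.ηc) * (c * S.τ * S.ηc) -
        (q + V * g * S.ηd) * (d * S.τ / S.ηd) := by
    intro c d
    unfold driftPlusPenalty change
    field_simp
    ring
  have hvar := clamp_variational (a := q + V * g / S.ηc) (b := q + V * g * S.ηd)
    (X := S.Pmax * S.τ * S.ηc) (Y := S.Pmax * S.τ / S.ηd)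
    (x := c * S.τ * S.ηc) (y := d * S.τ / S.ηd)
    (by linarith [hS.threshold_le hVg]) (by positivity) (by gcongr) (by positivity) (by gcongr)
  rw [key, key, onlineChange, change, change, hS.onlineCharge_mul hVg,
    hS.onlineDischarge_mul hVg]
  linarith

/-- Complementarity makes the sign of the energy change reveal which power is nonzero. This turns
uniqueness of the change into uniqueness of the pair. -/
theorem change_injOn (hS : S.IsRegular) {c d c' d' : ℝ} (h : S.PowerFeasible c d)
    (h' : S.PowerFeasible c' d') (he : S.change c d = S.change c' d') : c = c' ∧ d = d' := by
  have hτ := hS.τ_pos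
  have hc := hS.ηc_pos
  have hd := hS.ηd_pos
  obtain ⟨⟨hc0, -⟩, ⟨hd0, -⟩, h0⟩ := h
  obtain ⟨⟨hc0', -⟩, ⟨hd0', -⟩, h0'⟩ := h'
  have hu : 0 < S.τ * S.ηc := by positivity
  have hv : 0 < S.τ / S.ηd := by positivity
  have he : c * (S.τ * S.ηc) - d * (S.τ / S.ηd) = c' * (S.τ * S.ηc) - d' * (S.τ / S.ηd) := by
    unfold change at he; linarith [mul_div_assoc d S.τ S.ηd, mul_div_assoc d' S.τ S.ηd]
  generalize S.τ * S.ηc = u at *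
  generalize S.τ / S.ηd = v at *
  rcases mul_eq_zero.1 h0 with rfl | rfl <;> rcases mul_eq_zero.1 h0' with rfl | rfl
  · exact ⟨rfl, mul_right_cancel₀ hv.ne' (by linarith)⟩
  · have h1 : 0 ≤ d * v := by positivity
    have h2 : 0 ≤ c' * u := by positivity
    exact ⟨((mul_eq_zero.1 (by linarith : c' * u = 0)).resolve_right hu.ne').symm,
      (mul_eq_zero.1 (by linarith : d * v = 0)).resolve_right hv.ne'⟩
  · have h1 : 0 ≤ d' * v := by positivity
    have h2 : 0 ≤ c * u := by positivity
    exact ⟨(mul_eq_zero.1 (by linarith : c * u = 0)).resolve_right hu.ne',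
      ((mul_eq_zero.1 (by linarith : d' * v = 0)).resolve_right hv.ne').symm⟩
  · exact ⟨mul_right_cancel₀ hu.ne' (by linarith), rfl⟩

theorem isDriftPlusPenaltyOptimal_iff (hS : S.IsRegular) {V g : ℝ} (hVg : 0 ≤ V * g)
    (q c d : ℝ) : S.IsDriftPlusPenaltyOptimal V q g c d ↔
      c = S.onlineCharge V q g ∧ d = S.onlineDischarge V q g := by
  constructor
  · rintro ⟨hf, hopt⟩
    have hon := hS.powerFeasible_online hVg q
    have h1 := hopt _ _ hon
    have h2 := hS.driftPlusPenalty_online_add_le hVg q hf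
    have h3 : S.change c d - S.onlineChange V q g = 0 := by
      apply pow_eq_zero_iff (two_ne_zero) |>.1
      nlinarith [sq_nonneg (S.change c d - S.onlineChange V q g)]
    exact hS.change_injOn hf hon (sub_eq_zero.1 h3)
  · rintro ⟨rfl, rfl⟩
    refine ⟨hS.powerFeasible_online hVg q, fun c' d' hf => ?_⟩
    have h2 := hS.driftPlusPenalty_online_add_le hVg q hf
    nlinarith [sq_nonneg (S.change c' d' - S.onlineChange V q g)]

/-! ### One-step estimates: size, monotonicity, invariance. -/

theorem abs_change_le (hS : S.IsRegular) {c d : ℝ} (h : S.PowerFeasible c d) :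
    |S.change c d| ≤ S.Pmax * S.τ / S.ηd := by
  have hτ := hS.τ_pos
  have hc := hS.ηc_pos
  have hd := hS.ηd_pos
  obtain ⟨⟨hc0, hcP⟩, ⟨hd0, hdP⟩, -⟩ := h
  have h1 : c * S.τ * S.ηc ≤ S.Pmax * S.τ * S.ηc := by gcongr
  have h2 : d * S.τ / S.ηd ≤ S.Pmax * S.τ / S.ηd := by gcongr
  have h3 : 0 ≤ c * S.τ * S.ηc := by positivity
  have h4 : 0 ≤ d * S.τ / S.ηd := by positivity
  have h5 := hS.maxCharge_le_maxDischarge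
  unfold change
  rw [abs_le]
  constructor <;> linarith

/-- The two clamps act on disjoint ranges of q by `threshold_le`, each with slope 0 or -1, so the
sum with q has slope 0 or 1. -/
theorem add_onlineChange_mono (hS : S.IsRegular) {V g : ℝ} (hVg : 0 ≤ V * g) :
    Monotone fun q => q + S.onlineChange V q g := by
  intro q q' h
  have hth := hS.threshold_le hVg
  have hX := hS.maxCharge_nonneg
  have hY := hS.maxDischarge_nonneg
  simp only [hS.onlineChange_eq hVg]
  grind

/-- A unit of net output moves the stored energy by τ ηc when it reduces charging and by τ / ηd when
it adds discharging; τ ηc is the smaller rate. -/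
theorem netOutput_sub_le (hS : S.IsRegular) {V g : ℝ} (hVg : 0 ≤ V * g) {q q' : ℝ}
    (h : q ≤ q') :
    0 ≤ S.netOutput V q' g - S.netOutput V q g ∧
      (S.netOutput V q' g - S.netOutput V q g) * (S.τ * S.ηc) ≤
        S.onlineChange V q g - S.onlineChange V q' g := by
  have hτ := hS.τ_pos
  have hc := hS.ηc_pos
  have hd := hS.ηd_pos
  have hu : 0 < S.τ * S.ηc := by positivity
  have hv : 0 < S.τ / S.ηd := by positivity
  have huv : S.τ * S.ηc ≤ S.τ / S.ηd :=
    (mul_le_of_le_one_right hτ.le hS.ηc_le).trans (le_div_self hτ.le hd hS.ηd_le)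
  have hC : S.onlineCharge V q' g * (S.τ * S.ηc) ≤ S.onlineCharge V q g * (S.τ * S.ηc) := by
    rw [← mul_assoc, ← mul_assoc, hS.onlineCharge_mul hVg, hS.onlineCharge_mul hVg]
    gcongr
  have hD : S.onlineDischarge V q g * (S.τ / S.ηd) ≤
      S.onlineDischarge V q' g * (S.τ / S.ηd) := by
    rw [← mul_div_assoc, ← mul_div_assoc, hS.onlineDischarge_mul hVg,
      hS.onlineDischarge_mul hVg]
    gcongr
  have hC := le_of_mul_le_mul_right hC hu
  have hD := le_of_mul_le_mul_right hD hv
  rw [← onlineDischarge_sub_onlineCharge, ← onlineDischarge_sub_onlineCharge]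
  refine ⟨by linarith, ?_⟩
  have h1 : (S.onlineDischarge V q' g - S.onlineDischarge V q g) * (S.τ * S.ηc) ≤
      (S.onlineDischarge V q' g - S.onlineDischarge V q g) * (S.τ / S.ηd) := by
    gcongr
  unfold onlineChange change
  rw [mul_div_assoc, mul_div_assoc]
  linarith

/-- Charging stops at the threshold -V g / ηc and discharging at -V g ηd, so neither overshoots.
Hence the energy bounds hold although the one-period problem ignores them. -/
theorem add_onlineChange_mem (hS : S.IsRegular) {V g : ℝ} (hVg : 0 ≤ V * g) {q lo hi : ℝ}
    (hlo : lo ≤ -(V * g * S.ηd)) (hhi : -(V * g / S.ηc) ≤ hi) (hq : lo ≤ q ∧ q ≤ hi) :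
    lo ≤ q + S.onlineChange V q g ∧ q + S.onlineChange V q g ≤ hi := by
  have hth := hS.threshold_le hVg
  have hX := hS.maxCharge_nonneg
  have hY := hS.maxDischarge_nonneg
  simp only [hS.onlineChange_eq hVg]
  grind

theorem abs_netOutput_le (hS : S.IsRegular) {V g : ℝ} (hVg : 0 ≤ V * g) (q : ℝ) :
    |S.netOutput V q g| ≤ S.Pmax := by
  obtain ⟨⟨h1, h2⟩, ⟨h3, h4⟩, -⟩ := hS.powerFeasible_online hVg q
  rw [← onlineDischarge_sub_onlineCharge, abs_le]
  constructor <;> linarith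

end IsRegular

/-! ### Measurability, and the queue along a fixed price path. -/

theorem measurable_netOutput (S : Storage) (V : ℝ) :
    Measurable fun x : ℝ × ℝ => S.netOutput V x.1 x.2 := by
  unfold netOutput
  refine Measurable.ite (measurableSet_le (by fun_prop) (by fun_prop)) (by fun_prop) ?_
  refine Measurable.ite (measurableSet_le (by fun_prop) (by fun_prop)) (by fun_prop) ?_
  refine Measurable.ite (measurableSet_le (by fun_prop) (by fun_prop)) (by fun_prop) ?_
  exact Measurable.ite (measurableSet_le (by fun_prop) (by fun_prop)) (by fun_prop) (by fun_prop)

theorem measurable_onlineCharge (S : Storage) (V : ℝ) :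
    Measurable fun x : ℝ × ℝ => S.onlineCharge V x.1 x.2 :=
  (S.measurable_netOutput V).neg.max measurable_const

theorem measurable_onlineDischarge (S : Storage) (V : ℝ) :
    Measurable fun x : ℝ × ℝ => S.onlineDischarge V x.1 x.2 :=
  (S.measurable_netOutput V).max measurable_const

theorem measurable_onlineChange (S : Storage) (V : ℝ) :
    Measurable fun x : ℝ × ℝ => S.onlineChange V x.1 x.2 :=
  (((S.measurable_onlineCharge V).mul_const _).mul_const _).sub
    (((S.measurable_onlineDischarge V).mul_const _).div_const _)

/-- The virtual queue of the online strategy started at `x` along the price path `g`. -/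
noncomputable def queue (S : Storage) (V x : ℝ) (g : ℕ → ℝ) : ℕ → ℝ
  | 0 => x
  | t + 1 => S.queue V x g t + S.onlineChange V (S.queue V x g t) (g t)

/-- Revenue of the online strategy in period `t` along the price path `g`. -/
noncomputable def periodRevenue (S : Storage) (V x : ℝ) (g : ℕ → ℝ) (t : ℕ) : ℝ :=
  g t * S.netOutput V (S.queue V x g t) (g t) * S.τ

/-- Cumulative revenue of the online strategy along the price path `g`. -/
noncomputable def cumRevenue (S : Storage) (V x : ℝ) (g : ℕ → ℝ) (T : ℕ) : ℝ :=
  ∑ t ∈ Finset.range T, S.periodRevenue V x g t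

theorem onlineEnergy_sub {Ω : Type*} (S : Storage) (V E : ℝ) (e₀ : Ω → ℝ) (γ : ℕ → Ω → ℝ)
    (t : ℕ) (ω : Ω) :
    S.onlineEnergy V E e₀ γ t ω - E = S.queue V (e₀ ω - E) (fun t => γ t ω) t := by
  induction t with
  | zero => rfl
  | succ t ih =>
    rw [queue, ← ih, onlineChange, onlineEnergy]
    ring

theorem queue_add (S : Storage) (V x : ℝ) (g : ℕ → ℝ) (m n : ℕ) :
    S.queue V x g (m + n) = S.queue V (S.queue V x g m) (fun t => g (m + t)) n := by
  induction n with
  | zero => rfl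
  | succ n ih => rw [← add_assoc, queue, ih, queue]

theorem cumRevenue_add (S : Storage) (V x : ℝ) (g : ℕ → ℝ) (m n : ℕ) :
    S.cumRevenue V x g (m + n) = S.cumRevenue V x g m +
      S.cumRevenue V (S.queue V x g m) (fun t => g (m + t)) n := by
  simp only [cumRevenue, periodRevenue, Finset.sum_range_add, queue_add]

theorem queue_congr (S : Storage) (V x : ℝ) {g h : ℕ → ℝ} {t : ℕ} (hgh : ∀ i < t, g i = h i) :
    S.queue V x g t = S.queue V x h t := by
  induction t with
  | zero => rfl
  | succ t ih =>
    rw [queue, queue, ih fun i hi => hgh i (hi.trans t.lt_succ_self), hgh t t.lt_succ_self]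

theorem measurable_queue (S : Storage) (V : ℝ) (t : ℕ) :
    Measurable fun p : ℝ × (ℕ → ℝ) => S.queue V p.1 p.2 t := by
  induction t with
  | zero => exact measurable_fst
  | succ t ih =>
    exact ih.add ((S.measurable_onlineChange V).comp
      (ih.prodMk ((measurable_pi_apply t).comp measurable_snd)))

theorem measurable_periodRevenue (S : Storage) (V : ℝ) (t : ℕ) :
    Measurable fun p : ℝ × (ℕ → ℝ) => S.periodRevenue V p.1 p.2 t := by
  have hg : Measurable fun p : ℝ × (ℕ → ℝ) => p.2 t :=
    (measurable_pi_apply t).comp measurable_snd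
  exact (hg.mul ((S.measurable_netOutput V).comp
    ((S.measurable_queue V t).prodMk hg))).mul_const _

theorem measurable_cumRevenue (S : Storage) (V : ℝ) (T : ℕ) :
    Measurable fun p : ℝ × (ℕ → ℝ) => S.cumRevenue V p.1 p.2 T :=
  Finset.measurable_sum _ fun t _ => S.measurable_periodRevenue V t

namespace IsRegular

theorem queue_mem (hS : S.IsRegular) {V γlo γhi lo hi x : ℝ} {g : ℕ → ℝ} (hV : 0 ≤ V)
    (hγlo : 0 ≤ γlo) (hg : ∀ t, γlo ≤ g t ∧ g t ≤ γhi) (hlo : lo ≤ -(V * γhi * S.ηd))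
    (hhi : -(V * γlo / S.ηc) ≤ hi) (hx : lo ≤ x ∧ x ≤ hi) (t : ℕ) :
    lo ≤ S.queue V x g t ∧ S.queue V x g t ≤ hi := by
  induction t with
  | zero => exact hx
  | succ t ih =>
    have hc := hS.ηc_pos
    have hd := hS.ηd_pos
    have h1 : V * g t * S.ηd ≤ V * γhi * S.ηd := by gcongr; exact (hg t).2
    have h2 : V * γlo / S.ηc ≤ V * g t / S.ηc := by gcongr; exact (hg t).1
    exact hS.add_onlineChange_mem (mul_nonneg hV (hγlo.trans (hg t).1)) (by linarith)
      (by linarith) ih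

theorem abs_periodRevenue_le (hS : S.IsRegular) {V G : ℝ} {g : ℕ → ℝ} (hV : 0 ≤ V)
    (hg : ∀ t, 0 ≤ g t ∧ g t ≤ G) (x : ℝ) (t : ℕ) :
    |S.periodRevenue V x g t| ≤ G * S.Pmax * S.τ := by
  have h0 := (hg t).1
  have hτ := hS.τ_pos
  rw [periodRevenue, abs_mul, abs_mul, abs_of_nonneg h0, abs_of_pos hτ]
  gcongr
  · exact h0.trans (hg t).2
  · exact (hg t).2
  · exact hS.abs_netOutput_le (mul_nonneg hV h0) _

theorem abs_cumRevenue_le (hS : S.IsRegular) {V G : ℝ} {g : ℕ → ℝ} (hV : 0 ≤ V)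
    (hg : ∀ t, 0 ≤ g t ∧ g t ≤ G) (x : ℝ) (T : ℕ) :
    |S.cumRevenue V x g T| ≤ T * (G * S.Pmax * S.τ) := by
  refine (Finset.abs_sum_le_sum_abs _ _).trans ?_
  simpa using Finset.sum_le_card_nsmul (Finset.range T) _ _
    fun t _ => hS.abs_periodRevenue_le hV hg x t

/-- Each extra unit of energy sold from the higher start closes the gap by at least ηc, at a price
of at most G. -/
theorem cumRevenue_coupling (hS : S.IsRegular) {V G : ℝ} {g : ℕ → ℝ} (hV : 0 ≤ V)
    (hg : ∀ t, 0 ≤ g t ∧ g t ≤ G) {x y : ℝ} (hxy : x ≤ y) (T : ℕ) :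
    S.queue V x g T ≤ S.queue V y g T ∧ 0 ≤ S.cumRevenue V y g T - S.cumRevenue V x g T ∧
      S.cumRevenue V y g T - S.cumRevenue V x g T ≤
        G / S.ηc * ((y - x) - (S.queue V y g T - S.queue V x g T)) := by
  induction T with
  | zero => simpa [queue, cumRevenue] using hxy
  | succ T ih =>
    obtain ⟨h1, h2, h3⟩ := ih
    obtain ⟨hg0, hgG⟩ := hg T
    have hVg := mul_nonneg hV hg0
    have hτ := hS.τ_pos
    have hc := hS.ηc_pos
    obtain ⟨h4, h5⟩ := hS.netOutput_sub_le hVg h1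
    refine ⟨hS.add_onlineChange_mono hVg h1, ?_⟩
    simp only [cumRevenue, periodRevenue, Finset.sum_range_succ, queue] at h2 h3 ⊢
    set a := S.queue V x g T
    set b := S.queue V y g T
    set n := S.netOutput V b (g T) - S.netOutput V a (g T) with hn
    have h6 : n * S.τ ≤ (S.onlineChange V a (g T) - S.onlineChange V b (g T)) / S.ηc := by
      rw [le_div_iff₀ hc]; linarith
    have h7 : g T * (n * S.τ) ≤
        G * ((S.onlineChange V a (g T) - S.onlineChange V b (g T)) / S.ηc) := by
      gcongr
      exact hg0.trans hgG
    have h8 : 0 ≤ g T * (n * S.τ) := by positivity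
    have h9 : G * ((S.onlineChange V a (g T) - S.onlineChange V b (g T)) / S.ηc) =
        G / S.ηc * (S.onlineChange V a (g T) - S.onlineChange V b (g T)) := by ring
    have h10 : g T * (n * S.τ) = g T * S.netOutput V b (g T) * S.τ -
        g T * S.netOutput V a (g T) * S.τ := by rw [hn]; ring
    constructor <;> linarith

theorem abs_cumRevenue_sub_le (hS : S.IsRegular) {V G : ℝ} {g : ℕ → ℝ} (hV : 0 ≤ V)
    (hg : ∀ t, 0 ≤ g t ∧ g t ≤ G) {x y lo hi : ℝ} (hx : lo ≤ x ∧ x ≤ hi)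
    (hy : lo ≤ y ∧ y ≤ hi) (T : ℕ) :
    |S.cumRevenue V y g T - S.cumRevenue V x g T| ≤ G / S.ηc * (hi - lo) := by
  have hG : 0 ≤ G / S.ηc := div_nonneg ((hg 0).1.trans (hg 0).2) hS.ηc_pos.le
  wlog h : x ≤ y generalizing x y
  · rw [abs_sub_comm]
    exact this hy hx (le_of_not_ge h)
  obtain ⟨h1, h2, h3⟩ := hS.cumRevenue_coupling hV hg h T
  rw [abs_of_nonneg h2]
  refine h3.trans (mul_le_mul_of_nonneg_left ?_ hG)
  linarith [hx.1, hy.2]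

end IsRegular

/-- The exact quadratic term completes the square, so the drift telescopes along the queue. -/
theorem driftPlusPenalty_online_eq (S : Storage) (V q g : ℝ) :
    S.driftPlusPenalty V q g (S.onlineCharge V q g) (S.onlineDischarge V q g) =
      ((q + S.onlineChange V q g) ^ 2 - q ^ 2) / 2 - V * (g * S.netOutput V q g * S.τ) := by
  rw [driftPlusPenalty, ← onlineDischarge_sub_onlineCharge, onlineChange]
  ring

/-! ### Independent identically distributed prices and feasibility of the online strategy. -/

/-- Independent and identically distributed prices with values in `[γlo, γhi]`. -/
structure IsPriceProcess {Ω : Type*} [MeasurableSpace Ω] (μ : Measure Ω) (γ : ℕ → Ω → ℝ)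
    (γlo γhi : ℝ) : Prop where
  measurable : ∀ t, Measurable (γ t)
  indep : iIndepFun γ μ
  ident : ∀ t, IdentDistrib (γ t) (γ 0) μ μ
  range : ∀ᵐ ω ∂μ, ∀ t, γlo ≤ γ t ω ∧ γ t ω ≤ γhi

namespace IsPriceProcess

variable {Ω : Type*} [MeasurableSpace Ω] {μ : Measure Ω}
  {γ : ℕ → Ω → ℝ} {γlo γhi : ℝ}

theorem measurable_path (hγ : IsPriceProcess μ γ γlo γhi) : Measurable fun ω t => γ t ω :=
  measurable_pi_lambda _ hγ.measurable

theorem map_shift (hγ : IsPriceProcess μ γ γlo γhi) (m : ℕ) :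
    μ.map (fun ω t => γ (m + t) ω) = μ.map (fun ω t => γ t ω) := by
  have h := hγ.indep.precomp (add_right_injective m)
  rw [iIndepFun.map_fun_eq_infinitePi_map (X := fun t => γ (m + t))
      (fun t => hγ.measurable (m + t)) h,
    iIndepFun.map_fun_eq_infinitePi_map hγ.measurable hγ.indep]
  congr 1
  funext t
  rw [(hγ.ident (m + t)).map_eq, (hγ.ident t).map_eq]

theorem indepFun_queue (hγ : IsPriceProcess μ γ γlo γhi) (S : Storage) (V x : ℝ) (t : ℕ) :
    IndepFun (fun ω => S.queue V x (fun s => γ s ω) t) (γ t) μ := by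
  have h := hγ.indep.indepFun_finset (Finset.range t) {t} (by simp) hγ.measurable
  -- Prices from time t on are replaced by 0, which exhibits the queue as a function of the first t
  -- prices only.
  have hφ : Measurable fun f : Finset.range t → ℝ =>
      S.queue V x (fun i => if hi : i ∈ Finset.range t then f ⟨i, hi⟩ else 0) t := by
    have hext : ∀ i, Measurable fun f : Finset.range t → ℝ =>
        if hi : i ∈ Finset.range t then f ⟨i, hi⟩ else 0 := fun i => by
      split_ifs with hi
      · exact measurable_pi_apply (X := fun _ => ℝ) (⟨i, hi⟩ : Finset.range t)
      · exact measurable_const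
    exact (S.measurable_queue V t).comp (measurable_const.prodMk (measurable_pi_lambda _ hext))
  have hψ : Measurable fun f : ({t} : Finset ℕ) → ℝ => f ⟨t, by simp⟩ := measurable_pi_apply _
  have h' := h.comp hφ hψ
  have he : (fun ω => S.queue V x (fun s => γ s ω) t) =
      (fun f : Finset.range t → ℝ =>
        S.queue V x (fun i => if hi : i ∈ Finset.range t then f ⟨i, hi⟩ else 0) t) ∘
        (fun ω (i : Finset.range t) => γ i ω) := by
    funext ω
    refine S.queue_congr V x fun i hi => ?_
    simp [hi]
  rw [he]
  exact h'

theorem range_nonneg (hγ : IsPriceProcess μ γ γlo γhi) (hγlo : 0 ≤ γlo) :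
    ∀ᵐ ω ∂μ, ∀ t, 0 ≤ γ t ω ∧ γ t ω ≤ γhi := by
  filter_upwards [hγ.range] with ω h t using ⟨hγlo.trans (h t).1, (h t).2⟩

theorem shift (hγ : IsPriceProcess μ γ γlo γhi) (m : ℕ) :
    IsPriceProcess μ (fun t => γ (m + t)) γlo γhi where
  measurable t := hγ.measurable _
  indep := hγ.indep.precomp (add_right_injective m)
  ident t := (hγ.ident _).trans (hγ.ident _).symm
  range := by filter_upwards [hγ.range] with ω h t using h _

end IsPriceProcess

/-- The two conditions on E make [Emin - E, Emax - E] invariant for the queue at every admissible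
price. -/
theorem isOfflineFeasible_online {Ω : Type*} [MeasurableSpace Ω] {μ : Measure Ω}
    {γ : ℕ → Ω → ℝ} {γlo γhi V : ℝ} (hγ : IsPriceProcess μ γ γlo γhi) (hγlo : 0 ≤ γlo)
    (hS : S.IsRegular) (hV : 0 ≤ V) {E : ℝ} (hElo : S.Emin + V * γhi * S.ηd ≤ E)
    (hEhi : E ≤ S.Emax + V * γlo / S.ηc) {e₀ : Ω → ℝ} (he₀ : Measurable e₀)
    (he₀r : ∀ᵐ ω ∂μ, S.Emin ≤ e₀ ω ∧ e₀ ω ≤ S.Emax) :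
    S.IsOfflineFeasible μ
      (fun t ω => S.onlineCharge V (S.onlineEnergy V E e₀ γ t ω - E) (γ t ω))
      (fun t ω => S.onlineDischarge V (S.onlineEnergy V E e₀ γ t ω - E) (γ t ω))
      (S.onlineEnergy V E e₀ γ) := by
  have hm : ∀ t, Measurable fun ω => S.onlineEnergy V E e₀ γ t ω - E := fun t => by
    simp only [onlineEnergy_sub]
    exact (S.measurable_queue V t).comp ((he₀.sub_const E).prodMk hγ.measurable_path)
  refine ⟨fun t => (S.measurable_onlineCharge V).comp ((hm t).prodMk (hγ.measurable t)),
    fun t => (S.measurable_onlineDischarge V).comp ((hm t).prodMk (hγ.measurable t)),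
    fun t => by simpa using (hm t).add_const E, ?_, ae_of_all _ fun ω t => rfl, ?_⟩
  · filter_upwards [hγ.range_nonneg hγlo] with ω hω t
    exact hS.powerFeasible_online (mul_nonneg hV (hω t).1) _
  · filter_upwards [hγ.range, he₀r] with ω hω h0 t
    have h := hS.queue_mem (lo := S.Emin - E) (hi := S.Emax - E) (x := e₀ ω - E) hV hγlo hω
      (by linarith) (by linarith) ⟨by linarith [h0.1], by linarith [h0.2]⟩ t
    rw [← S.onlineEnergy_sub V E e₀ γ t ω] at h
    exact ⟨by linarith [h.1], by linarith [h.2]⟩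

/-! ### Existence of the long-run average revenue. -/

variable {Ω : Type*} [MeasurableSpace Ω] {μ : Measure Ω} [IsProbabilityMeasure μ]
  {γ : ℕ → Ω → ℝ} {γlo γhi V : ℝ}

namespace IsPriceProcess

theorem nonneg_hi (hγ : IsPriceProcess μ γ γlo γhi) (hγlo : 0 ≤ γlo) : 0 ≤ γhi := by
  obtain ⟨ω, hω⟩ := (hγ.range_nonneg hγlo).exists
  exact (hω 0).1.trans (hω 0).2

theorem integrable_periodRevenue (hγ : IsPriceProcess μ γ γlo γhi) (hγlo : 0 ≤ γlo)
    (hS : S.IsRegular) (hV : 0 ≤ V) {x : Ω → ℝ} (hx : Measurable x) (t : ℕ) :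
    Integrable (fun ω => S.periodRevenue V (x ω) (fun s => γ s ω) t) μ := by
  refine Integrable.of_bound ((S.measurable_periodRevenue V t).comp
    (hx.prodMk hγ.measurable_path)).aestronglyMeasurable (γhi * S.Pmax * S.τ) ?_
  filter_upwards [hγ.range_nonneg hγlo] with ω hω using hS.abs_periodRevenue_le hV hω _ _

theorem integrable_cumRevenue (hγ : IsPriceProcess μ γ γlo γhi) (hγlo : 0 ≤ γlo)
    (hS : S.IsRegular) (hV : 0 ≤ V) {x : Ω → ℝ} (hx : Measurable x) (T : ℕ) :
    Integrable (fun ω => S.cumRevenue V (x ω) (fun s => γ s ω) T) μ :=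
  integrable_finsetSum _ fun t _ => hγ.integrable_periodRevenue hγlo hS hV hx t

theorem abs_integral_cumRevenue_sub_le (hγ : IsPriceProcess μ γ γlo γhi) (hγlo : 0 ≤ γlo)
    (hS : S.IsRegular) (hV : 0 ≤ V) {x y : Ω → ℝ} (hx : Measurable x) (hy : Measurable y)
    {lo hi : ℝ} (hxr : ∀ᵐ ω ∂μ, lo ≤ x ω ∧ x ω ≤ hi) (hyr : ∀ᵐ ω ∂μ, lo ≤ y ω ∧ y ω ≤ hi)
    (T : ℕ) :
    |(∫ ω, S.cumRevenue V (y ω) (fun s => γ s ω) T ∂μ) -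
      ∫ ω, S.cumRevenue V (x ω) (fun s => γ s ω) T ∂μ| ≤ γhi / S.ηc * (hi - lo) := by
  rw [← integral_sub (hγ.integrable_cumRevenue hγlo hS hV hy T)
    (hγ.integrable_cumRevenue hγlo hS hV hx T)]
  have h := norm_integral_le_of_norm_le_const (μ := μ) (C := γhi / S.ηc * (hi - lo))
    (f := fun ω => S.cumRevenue V (y ω) (fun s => γ s ω) T -
      S.cumRevenue V (x ω) (fun s => γ s ω) T) (by
      filter_upwards [hγ.range_nonneg hγlo, hxr, hyr] with ω h1 h2 h3
      exact hS.abs_cumRevenue_sub_le hV h1 h2 h3 T)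
  simpa using h

theorem exists_tendsto_cumRevenue (hγ : IsPriceProcess μ γ γlo γhi) (hγlo : 0 ≤ γlo)
    (hS : S.IsRegular) (hV : 0 ≤ V) {lo hi : ℝ} (hlo : lo ≤ -(V * γhi * S.ηd))
    (hhi : -(V * γlo / S.ηc) ≤ hi) {x : ℝ} (hx : lo ≤ x ∧ x ≤ hi) :
    ∃ v, Tendsto (fun T : ℕ => (∫ ω, S.cumRevenue V x (fun s => γ s ω) T ∂μ) / T) atTop (𝓝 v) := by
  set K := γhi / S.ηc * (hi - lo) with hK
  set a : ℕ → ℝ := fun T => ∫ ω, S.cumRevenue V x (fun s => γ s ω) T ∂μ with ha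
  have hK0 : 0 ≤ K := mul_nonneg (div_nonneg (hγ.nonneg_hi hγlo) hS.ηc_pos.le)
    (by linarith [hx.1, hx.2])
  have hB0 : 0 ≤ γhi * S.Pmax * S.τ :=
    mul_nonneg (mul_nonneg (hγ.nonneg_hi hγlo) hS.Pmax_nonneg) hS.τ_pos.le
  have hbound : ∀ T, |a T| ≤ T * (γhi * S.Pmax * S.τ) := fun T => by
    have h := norm_integral_le_of_norm_le_const (μ := μ) (C := T * (γhi * S.Pmax * S.τ))
      (f := fun ω => S.cumRevenue V x (fun s => γ s ω) T) (by
        filter_upwards [hγ.range_nonneg hγlo] with ω hω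
        exact hS.abs_cumRevenue_le hV hω x T)
    simpa using h
  -- Restart at time m: replacing the random state by x costs at most K, and the shifted prices have
  -- the same law. The coupling is pathwise, so the state may be random.
  have hsub : Subadditive fun T => a T + K := by
    intro m n
    have hq : Measurable fun ω => S.queue V x (fun s => γ s ω) m :=
      (S.measurable_queue V m).comp (measurable_const.prodMk hγ.measurable_path)
    have hqr : ∀ᵐ ω ∂μ, lo ≤ S.queue V x (fun s => γ s ω) m ∧
        S.queue V x (fun s => γ s ω) m ≤ hi := by
      filter_upwards [hγ.range] with ω hω using hS.queue_mem hV hγlo hω hlo hhi hx m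
    have h1 : a (m + n) = a m + ∫ ω, S.cumRevenue V (S.queue V x (fun s => γ s ω) m)
        (fun t => γ (m + t) ω) n ∂μ := by
      rw [ha]
      simp only [cumRevenue_add]
      exact integral_add (hγ.integrable_cumRevenue hγlo hS hV measurable_const m)
        ((hγ.shift m).integrable_cumRevenue hγlo hS hV hq n)
    have h2 := (hγ.shift m).abs_integral_cumRevenue_sub_le hγlo hS hV
      (measurable_const (a := x)) hq (ae_of_all _ fun _ => hx) hqr n
    have h3 : ∫ ω, S.cumRevenue V x (fun t => γ (m + t) ω) n ∂μ = a n := by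
      have hm : Measurable fun g : ℕ → ℝ => S.cumRevenue V x g n :=
        (S.measurable_cumRevenue V n).comp (measurable_const.prodMk measurable_id)
      rw [ha, ← integral_map (φ := fun ω t => γ (m + t) ω) (f := fun g => S.cumRevenue V x g n)
          (hγ.shift m).measurable_path.aemeasurable hm.aestronglyMeasurable,
        hγ.map_shift m, integral_map hγ.measurable_path.aemeasurable hm.aestronglyMeasurable]
    rw [h3] at h2
    have h4 := (abs_le.1 h2).2
    show a (m + n) + K ≤ a m + K + (a n + K)
    linarith
  have hbdd : BddBelow (Set.range fun n : ℕ => (a n + K) / n) := by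
    refine ⟨-(γhi * S.Pmax * S.τ), ?_⟩
    rintro _ ⟨n, rfl⟩
    -- At n = 0 the quotient is 0 by convention, so the lower bound must be nonpositive.
    rcases n.eq_zero_or_pos with rfl | hn
    · simpa using hB0
    · have hn : (0 : ℝ) < n := Nat.cast_pos.2 hn
      show _ ≤ (a n + K) / n
      rw [le_div_iff₀ hn]
      linarith [(abs_le.1 (hbound n)).1]
  refine ⟨hsub.lim, ?_⟩
  have h := (hsub.tendsto_lim hbdd).sub (tendsto_const_div_atTop_nhds_zero_nat K)
  simpa [add_div] using h

end IsPriceProcess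

/-! ### Comparison with the offline values. -/

/-- The drift-plus-penalty term achieved by the online strategy. -/
noncomputable def onlinePenalty (S : Storage) (V q g : ℝ) : ℝ :=
  S.driftPlusPenalty V q g (S.onlineCharge V q g) (S.onlineDischarge V q g)

theorem measurable_onlinePenalty (S : Storage) (V : ℝ) :
    Measurable fun x : ℝ × ℝ => S.onlinePenalty V x.1 x.2 := by
  unfold onlinePenalty driftPlusPenalty change
  have hc := S.measurable_onlineCharge V
  have hd := S.measurable_onlineDischarge V
  fun_prop

theorem measurable_onlinePenalty_right (S : Storage) (V q : ℝ) :
    Measurable (S.onlinePenalty V q) :=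
  (S.measurable_onlinePenalty V).of_uncurry_left

theorem IsRegular.abs_onlinePenalty_le (hS : S.IsRegular) {q g Q : ℝ} (hV : 0 ≤ V)
    (hg : 0 ≤ g ∧ g ≤ γhi) (hq : |q| ≤ Q) :
    |S.onlinePenalty V q g| ≤ (S.Pmax * S.τ / S.ηd) ^ 2 / 2 + S.Pmax * S.τ / S.ηd * Q +
      V * (γhi * S.Pmax * S.τ) := by
  have hY := hS.maxDischarge_nonneg
  have h1 : |S.onlineChange V q g| ≤ S.Pmax * S.τ / S.ηd :=
    hS.abs_change_le (hS.powerFeasible_online (mul_nonneg hV hg.1) q)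
  have h2 : |g * S.netOutput V q g * S.τ| ≤ γhi * S.Pmax * S.τ :=
    hS.abs_periodRevenue_le (g := fun _ => g) hV (fun _ => hg) q 0
  have h3 : S.onlinePenalty V q g = S.onlineChange V q g ^ 2 / 2 + S.onlineChange V q g * q +
      -(V * (g * S.netOutput V q g * S.τ)) := by
    rw [onlinePenalty, driftPlusPenalty_online_eq]; ring
  rw [h3]
  refine (abs_add_three _ _ _).trans ?_
  rw [abs_neg, abs_mul, abs_mul V, abs_of_nonneg hV, abs_div, abs_pow, abs_two]
  gcongr

namespace IsPriceProcess

/-- With q constant, the terms q (e (t + 1) - e t) telescope whatever the offline decisions know of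
the future. The online choice is optimal for each outcome, so anticipation does not affect the
comparison. -/
theorem integral_onlinePenalty_le (hγ : IsPriceProcess μ γ γlo γhi) (hγlo : 0 ≤ γlo)
    (hS : S.IsRegular) (hV : 0 ≤ V) {w : ℝ} (hw : w ∈ S.offlineValues μ γ) (q : ℝ) :
    ∫ ω, S.onlinePenalty V q (γ 0 ω) ∂μ ≤ (S.Pmax * S.τ / S.ηd) ^ 2 / 2 - V * w := by
  obtain ⟨c, d, e, hf, hlim⟩ := hw
  set B := (S.Pmax * S.τ / S.ηd) ^ 2 / 2 with hB
  set Φ := ∫ ω, S.onlinePenalty V q (γ 0 ω) ∂μ with hΦ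
  have hc := hf.measurable_pc
  have hd := hf.measurable_pd
  have hr : ∀ t, Integrable (fun ω => γ t ω * (d t ω - c t ω) * S.τ) μ := fun t => by
    have := hγ.measurable t
    refine Integrable.of_bound (by fun_prop : Measurable _).aestronglyMeasurable
      (γhi * S.Pmax * S.τ) ?_
    filter_upwards [hγ.range_nonneg hγlo, hf.power] with ω h1 h2
    obtain ⟨⟨hc0, hcP⟩, ⟨hd0, hdP⟩, -⟩ := h2 t
    obtain ⟨hg0, hg1⟩ := h1 t
    have hτ := hS.τ_pos
    have : |d t ω - c t ω| ≤ S.Pmax := abs_le.2 ⟨by linarith, by linarith⟩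
    rw [Real.norm_eq_abs, abs_mul, abs_mul, abs_of_nonneg hg0, abs_of_pos hτ]
    gcongr
    exact hg0.trans hg1
  have he : ∀ t, Integrable (e t) μ := fun t => by
    refine Integrable.of_bound (hf.measurable_e t).aestronglyMeasurable
      (max |S.Emin| |S.Emax|) ?_
    filter_upwards [hf.range] with ω h using abs_le_max_abs_abs (h t).1 (h t).2
  have hpen : ∀ t, Integrable (fun ω => S.onlinePenalty V q (γ t ω)) μ := fun t => by
    refine Integrable.of_bound ((S.measurable_onlinePenalty_right V q).comp
      (hγ.measurable t)).aestronglyMeasurable ((S.Pmax * S.τ / S.ηd) ^ 2 / 2 +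
        S.Pmax * S.τ / S.ηd * |q| + V * (γhi * S.Pmax * S.τ)) ?_
    · filter_upwards [hγ.range_nonneg hγlo] with ω h1
      exact hS.abs_onlinePenalty_le hV (h1 t) le_rfl
  -- B absorbs the squared offline energy change; the square gained by optimality is discarded.
  have hstep : ∀ t, Φ ≤ B + q * ((∫ ω, e (t + 1) ω ∂μ) - ∫ ω, e t ω ∂μ) -
      V * ∫ ω, γ t ω * (d t ω - c t ω) * S.τ ∂μ := fun t => by
    have h1 : Φ = ∫ ω, S.onlinePenalty V q (γ t ω) ∂μ :=
      (((hγ.ident t).comp (S.measurable_onlinePenalty_right V q)).integral_eq).symm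
    have h2 : ∫ ω, (B + q * (e (t + 1) ω - e t ω) - V * (γ t ω * (d t ω - c t ω) * S.τ)) ∂μ =
        B + q * ((∫ ω, e (t + 1) ω ∂μ) - ∫ ω, e t ω ∂μ) -
          V * ∫ ω, γ t ω * (d t ω - c t ω) * S.τ ∂μ := by
      have i1 := ((he (t + 1)).sub (he t)).const_mul q
      have i2 := (hr t).const_mul V
      have i3 := (integrable_const (μ := μ) B).add i1
      refine (integral_sub i3 i2).trans ?_
      rw [integral_const_mul]
      congr 1
      refine (integral_add (integrable_const B) i1).trans ?_
      rw [integral_const_mul]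
      congr 1
      · simp
      · congr 1
        exact integral_sub (he (t + 1)) (he t)
    rw [h1, ← h2]
    refine integral_mono_ae (hpen t) ?_ ?_
    · exact ((integrable_const B).add (((he (t + 1)).sub (he t)).const_mul q)).sub
        ((hr t).const_mul V)
    · filter_upwards [hγ.range_nonneg hγlo, hf.power, hf.dynamics] with ω h1 h2 h3
      have h4 := hS.driftPlusPenalty_online_add_le (mul_nonneg hV (h1 t).1) q (h2 t)
      have h5 := sq_le_sq' (neg_le_of_abs_le (hS.abs_change_le (h2 t)))
        (le_of_abs_le (hS.abs_change_le (h2 t)))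
      have h6 := sq_nonneg (S.change (c t ω) (d t ω) - S.onlineChange V q (γ t ω))
      have h7 := h3 t
      have h8 : e (t + 1) ω - e t ω = S.change (c t ω) (d t ω) := by linarith
      show S.onlinePenalty V q (γ t ω) ≤
        B + q * (e (t + 1) ω - e t ω) - V * (γ t ω * (d t ω - c t ω) * S.τ)
      rw [h8, hB]
      unfold onlinePenalty
      rw [driftPlusPenalty] at h4 ⊢
      rw [driftPlusPenalty] at h4
      linarith
  have hsum : ∀ T : ℕ, T * Φ ≤ T * B + q * ((∫ ω, e T ω ∂μ) - ∫ ω, e 0 ω ∂μ) -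
      V * ∑ t ∈ Finset.range T, ∫ ω, γ t ω * (d t ω - c t ω) * S.τ ∂μ := fun T => by
    induction T with
    | zero => simp
    | succ T ih =>
      rw [Finset.sum_range_succ]
      push_cast
      linarith [hstep T]
  have heb : ∀ t, |∫ ω, e t ω ∂μ| ≤ max |S.Emin| |S.Emax| := fun t => by
    have h := norm_integral_le_of_norm_le_const (μ := μ) (C := max |S.Emin| |S.Emax|)
      (f := e t) (by
        filter_upwards [hf.range] with ω h using abs_le_max_abs_abs (h t).1 (h t).2)
    simpa using h
  set M := |q| * (2 * max |S.Emin| |S.Emax|) with hM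
  have hfin : ∀ᶠ T : ℕ in atTop, Φ ≤ B + M / T - V * S.avgRevenue μ γ c d T := by
    filter_upwards [eventually_gt_atTop 0] with T hT
    have hT : (0 : ℝ) < T := Nat.cast_pos.2 hT
    have h1 : q * ((∫ ω, e T ω ∂μ) - ∫ ω, e 0 ω ∂μ) ≤ M := by
      refine (le_abs_self _).trans ?_
      rw [abs_mul]
      refine mul_le_mul_of_nonneg_left ((abs_sub _ _).trans ?_) (abs_nonneg q)
      linarith [heb T, heb 0]
    have h2 := hsum T
    refine le_of_mul_le_mul_left ?_ hT
    have h3 : T * (B + M / T - V * S.avgRevenue μ γ c d T) = T * B + M -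
        V * ∑ t ∈ Finset.range T, ∫ ω, γ t ω * (d t ω - c t ω) * S.τ ∂μ := by
      unfold avgRevenue
      generalize ∑ t ∈ Finset.range T, ∫ ω, γ t ω * (d t ω - c t ω) * S.τ ∂μ = R
      field_simp
    linarith
  have hl : Tendsto (fun T : ℕ => B + M / T - V * S.avgRevenue μ γ c d T) atTop
      (𝓝 (B + 0 - V * w)) :=
    ((tendsto_const_nhds).add (tendsto_const_div_atTop_nhds_zero_nat M)).sub (hlim.const_mul V)
  rw [add_zero] at hl
  exact ge_of_tendsto hl hfin

theorem integral_onlinePenalty_queue_le (hγ : IsPriceProcess μ γ γlo γhi) (hγlo : 0 ≤ γlo)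
    (hS : S.IsRegular) (hV : 0 ≤ V) {lo hi : ℝ} (hlo : lo ≤ -(V * γhi * S.ηd))
    (hhi : -(V * γlo / S.ηc) ≤ hi) {x : ℝ} (hx : lo ≤ x ∧ x ≤ hi) {w : ℝ}
    (hw : w ∈ S.offlineValues μ γ) (t : ℕ) :
    Integrable (fun ω => S.onlinePenalty V (S.queue V x (fun s => γ s ω) t) (γ t ω)) μ ∧
    ∫ ω, S.onlinePenalty V (S.queue V x (fun s => γ s ω) t) (γ t ω) ∂μ ≤
      (S.Pmax * S.τ / S.ηd) ^ 2 / 2 - V * w := by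
  have hq : Measurable fun ω => S.queue V x (fun s => γ s ω) t :=
    (S.measurable_queue V t).comp (measurable_const.prodMk hγ.measurable_path)
  have hγt := hγ.measurable t
  have hpair := hq.prodMk hγt
  have hm := S.measurable_onlinePenalty V
  have hint : Integrable
      (fun ω => S.onlinePenalty V (S.queue V x (fun s => γ s ω) t) (γ t ω)) μ := by
    refine Integrable.of_bound (hm.comp hpair).aestronglyMeasurable
      ((S.Pmax * S.τ / S.ηd) ^ 2 / 2 + S.Pmax * S.τ / S.ηd * max |lo| |hi| +
        V * (γhi * S.Pmax * S.τ)) ?_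
    filter_upwards [hγ.range] with ω hω
    have h := hS.queue_mem hV hγlo hω hlo hhi hx t
    exact hS.abs_onlinePenalty_le hV ⟨hγlo.trans (hω t).1, (hω t).2⟩
      (abs_le_max_abs_abs h.1 h.2)
  refine ⟨hint, ?_⟩
  have hprod := (indepFun_iff_map_prod_eq_prod_map_map hq.aemeasurable hγt.aemeasurable).1
    (hγ.indepFun_queue S V x t)
  have := Measure.isProbabilityMeasure_map (μ := μ) hq.aemeasurable
  have := Measure.isProbabilityMeasure_map (μ := μ) hγt.aemeasurable
  have hint' : Integrable (fun p : ℝ × ℝ => S.onlinePenalty V p.1 p.2)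
      ((μ.map fun ω => S.queue V x (fun s => γ s ω) t).prod (μ.map (γ t))) := by
    rw [← hprod]
    exact (integrable_map_measure hm.aestronglyMeasurable hpair.aemeasurable).2 hint
  rw [← integral_map (f := fun p : ℝ × ℝ => S.onlinePenalty V p.1 p.2) hpair.aemeasurable
    hm.aestronglyMeasurable, hprod, integral_prod _ hint']
  -- By independence the joint law is a product, so integrating over the price first meets the
  -- frozen-queue bound, which is uniform in q.
  have hconst : ∀ q, ∫ g, S.onlinePenalty V q g ∂(μ.map (γ t)) ≤
      (S.Pmax * S.τ / S.ηd) ^ 2 / 2 - V * w := fun q => by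
    rw [(hγ.ident t).map_eq, integral_map (hγ.measurable 0).aemeasurable
      (S.measurable_onlinePenalty_right V q).aestronglyMeasurable]
    exact hγ.integral_onlinePenalty_le hγlo hS hV hw q
  calc _ ≤ ∫ _, ((S.Pmax * S.τ / S.ηd) ^ 2 / 2 - V * w)
        ∂(μ.map fun ω => S.queue V x (fun s => γ s ω) t) :=
        integral_mono hint'.integral_prod_left (integrable_const _) hconst
    _ = _ := by simp

theorem offlineValue_le (hγ : IsPriceProcess μ γ γlo γhi) (hγlo : 0 ≤ γlo)
    (hS : S.IsRegular) (hV : 0 < V) {lo hi : ℝ} (hlo : lo ≤ -(V * γhi * S.ηd))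
    (hhi : -(V * γlo / S.ηc) ≤ hi) {x : ℝ} (hx : lo ≤ x ∧ x ≤ hi) {w v : ℝ}
    (hw : w ∈ S.offlineValues μ γ)
    (hv : Tendsto (fun T : ℕ => (∫ ω, S.cumRevenue V x (fun s => γ s ω) T ∂μ) / T) atTop (𝓝 v)) :
    w - (S.Pmax * S.τ) ^ 2 / (2 * V * S.ηd ^ 2) ≤ v := by
  set B := (S.Pmax * S.τ / S.ηd) ^ 2 / 2 with hB
  have hpen := fun t => hγ.integral_onlinePenalty_queue_le hγlo hS hV.le hlo hhi hx hw t
  have hpath : ∀ T ω, ∑ t ∈ Finset.range T,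
      S.onlinePenalty V (S.queue V x (fun s => γ s ω) t) (γ t ω) =
        (S.queue V x (fun s => γ s ω) T ^ 2 - x ^ 2) / 2 -
          V * S.cumRevenue V x (fun s => γ s ω) T := fun T ω => by
    induction T with
    | zero => simp [queue, cumRevenue]
    | succ T ih =>
      rw [Finset.sum_range_succ, ih, onlinePenalty, driftPlusPenalty_online_eq,
        cumRevenue, cumRevenue, Finset.sum_range_succ, queue, periodRevenue]
      ring
  have hsum : ∀ T : ℕ, -(x ^ 2 / 2) - V * ∫ ω, S.cumRevenue V x (fun s => γ s ω) T ∂μ ≤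
      T * (B - V * w) := fun T => by
    have i1 := hγ.integrable_cumRevenue hγlo hS hV.le (measurable_const (a := x)) T
    calc _ = ∫ ω, (-(x ^ 2 / 2) - V * S.cumRevenue V x (fun s => γ s ω) T) ∂μ := by
          rw [integral_sub (integrable_const _) (i1.const_mul V), integral_const_mul]
          simp
      _ ≤ ∫ ω, ∑ t ∈ Finset.range T,
          S.onlinePenalty V (S.queue V x (fun s => γ s ω) t) (γ t ω) ∂μ := by
          refine integral_mono ((integrable_const _).sub (i1.const_mul V))
            (integrable_finsetSum _ fun t _ => (hpen t).1) fun ω => ?_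
          show _ ≤ ∑ t ∈ Finset.range T, _
          rw [hpath]
          show -(x ^ 2 / 2) - V * S.cumRevenue V x (fun s => γ s ω) T ≤ _
          -- The final squared queue is dropped; only the constant x² / 2 remains, and it vanishes
          -- after division by T.
          linarith [sq_nonneg (S.queue V x (fun s => γ s ω) T)]
      _ = ∑ t ∈ Finset.range T, ∫ ω,
          S.onlinePenalty V (S.queue V x (fun s => γ s ω) t) (γ t ω) ∂μ :=
          integral_finsetSum _ fun t _ => (hpen t).1
      _ ≤ T * (B - V * w) := by
          simpa using Finset.sum_le_card_nsmul (Finset.range T) _ _ fun t _ => (hpen t).2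
  have hlim : Tendsto (fun T : ℕ => -((x ^ 2 / 2) / T) -
      V * ((∫ ω, S.cumRevenue V x (fun s => γ s ω) T ∂μ) / T)) atTop (𝓝 (-0 - V * v)) :=
    (tendsto_const_div_atTop_nhds_zero_nat _).neg.sub (hv.const_mul V)
  have hle : -0 - V * v ≤ B - V * w := by
    refine le_of_tendsto hlim ?_
    filter_upwards [eventually_gt_atTop 0] with T hT
    have hT : (0 : ℝ) < T := Nat.cast_pos.2 hT
    have h := hsum T
    refine le_of_mul_le_mul_left ?_ hT
    refine le_trans (le_of_eq ?_) h
    field_simp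
  have hBV : (S.Pmax * S.τ) ^ 2 / (2 * V * S.ηd ^ 2) = B / V := by
    have := hS.ηd_pos
    rw [hB]; field_simp
  rw [hBV, sub_le_comm, le_div_iff₀ hV]
  linarith

end IsPriceProcess

/-! ### Assembling the theorem. -/

theorem onlineAvgRevenue_eq (hγ : IsPriceProcess μ γ γlo γhi) (hγlo : 0 ≤ γlo)
    (hS : S.IsRegular) (hV : 0 ≤ V) (E : ℝ) {e₀ : Ω → ℝ} (he₀ : Measurable e₀) (T : ℕ) :
    S.onlineAvgRevenue μ V E e₀ γ T =
      (∫ ω, S.cumRevenue V (e₀ ω - E) (fun s => γ s ω) T ∂μ) / T := by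
  have h : ∫ ω, S.cumRevenue V (e₀ ω - E) (fun s => γ s ω) T ∂μ =
      ∑ t ∈ Finset.range T, ∫ ω, S.periodRevenue V (e₀ ω - E) (fun s => γ s ω) t ∂μ :=
    integral_finsetSum _ fun t _ =>
      hγ.integrable_periodRevenue hγlo hS hV (he₀.sub_const E) t
  rw [h, onlineAvgRevenue, avgRevenue, div_mul_eq_mul_div, one_mul]
  simp only [onlineDischarge_sub_onlineCharge, onlineEnergy_sub, periodRevenue]

end Storage

theorem theorem2 {Ω : Type*} [MeasurableSpace Ω] (μ : Measure Ω) [IsProbabilityMeasure μ]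
    (S : Storage) (hP : 0 ≤ S.Pmax) (hτ : 0 < S.τ)
    (hηc : 0 < S.ηc) (hηc1 : S.ηc ≤ 1) (hηd : 0 < S.ηd) (hηd1 : S.ηd ≤ 1)
    (γ : ℕ → Ω → ℝ) (hγm : ∀ t, Measurable (γ t))
    (hγindep : iIndepFun γ μ) (hγid : ∀ t, IdentDistrib (γ t) (γ 0) μ μ)
    (γlo γhi : ℝ) (hγrange : ∀ t, ∀ᵐ ω ∂μ, γlo ≤ γ t ω ∧ γ t ω ≤ γhi)
    (hγlo : 0 ≤ γlo) (hγlohi : γlo < γhi * S.ηc * S.ηd)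
    (V E : ℝ) (hV : 0 < V)
    (hVmax : V ≤ S.ηc * (S.Emax - S.Emin) / (γhi * S.ηc * S.ηd - γlo))
    (hElo : S.Emin + V * γhi * S.ηd ≤ E) (hEhi : E ≤ S.Emax + V * γlo / S.ηc)
    (e₀ : Ω → ℝ) (he₀m : Measurable e₀)
    (he₀range : ∀ᵐ ω ∂μ, S.Emin ≤ e₀ ω ∧ e₀ ω ≤ S.Emax)
    (he₀indep : IndepFun e₀ (fun ω t => γ t ω) μ) :
    (∀ q g : ℝ, γlo ≤ g → g ≤ γhi → ∀ c d : ℝ,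
      (S.IsDriftPlusPenaltyOptimal V q g c d ↔
        c = S.onlineCharge V q g ∧ d = S.onlineDischarge V q g)) ∧
    ∃ v₀ v : ℝ, IsLUB (S.offlineValues μ γ) v₀ ∧
      Tendsto (S.onlineAvgRevenue μ V E e₀ γ) atTop (𝓝 v) ∧
      v₀ - (S.Pmax * S.τ) ^ 2 / (2 * V * S.ηd ^ 2) ≤ v ∧ v ≤ v₀ := by
  have hS : S.IsRegular := ⟨hP, hτ, hηc, hηc1, hηd, hηd1⟩
  have hγ : Storage.IsPriceProcess μ γ γlo γhi :=
    ⟨hγm, hγindep, hγid, ae_all_iff.2 hγrange⟩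
  refine ⟨fun q g hg _ c d =>
    hS.isDriftPlusPenaltyOptimal_iff (mul_nonneg hV.le (hγlo.trans hg)) q c d, ?_⟩
  have hlo : S.Emin - E ≤ -(V * γhi * S.ηd) := by linarith
  have hhi : -(V * γlo / S.ηc) ≤ S.Emax - E := by linarith
  -- The limit is taken from the deterministic start Emin. That Emin ≤ Emax follows from the range
  -- of `e₀`.
  have hx : S.Emin - E ≤ S.Emin - E ∧ S.Emin - E ≤ S.Emax - E := by
    obtain ⟨ω, hω⟩ := he₀range.exists
    exact ⟨le_rfl, by linarith [hω.1, hω.2]⟩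
  obtain ⟨v, hv⟩ := hγ.exists_tendsto_cumRevenue hγlo hS hV.le hlo hhi hx
  have hon : Tendsto (S.onlineAvgRevenue μ V E e₀ γ) atTop (𝓝 v) := by
    -- By the coupling, the start `e₀` changes the expected total revenue by a bounded amount, hence
    -- not the average in the limit.
    have hdiff : Tendsto (fun T : ℕ => S.onlineAvgRevenue μ V E e₀ γ T -
        (∫ ω, S.cumRevenue V (S.Emin - E) (fun s => γ s ω) T ∂μ) / T) atTop (𝓝 0) := by
      refine squeeze_zero_norm (fun T => ?_) (tendsto_const_div_atTop_nhds_zero_nat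
        (γhi / S.ηc * ((S.Emax - E) - (S.Emin - E))))
      rw [Storage.onlineAvgRevenue_eq hγ hγlo hS hV.le E he₀m, ← sub_div, norm_div,
        Real.norm_natCast]
      refine div_le_div_of_nonneg_right ?_ T.cast_nonneg
      refine hγ.abs_integral_cumRevenue_sub_le hγlo hS hV.le measurable_const
        (he₀m.sub_const E) (ae_of_all _ fun _ => hx) ?_ T
      filter_upwards [he₀range] with ω hω
      exact ⟨by linarith [hω.1], by linarith [hω.2]⟩
    simpa using hdiff.add hv
  -- Membership gives v ≤ v₀, and also the nonemptiness required for the supremum.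
  have hmem : v ∈ S.offlineValues μ γ :=
    ⟨_, _, _, Storage.isOfflineFeasible_online hγ hγlo hS hV.le hElo hEhi he₀m he₀range, hon⟩
  have hle : ∀ w ∈ S.offlineValues μ γ,
      w - (S.Pmax * S.τ) ^ 2 / (2 * V * S.ηd ^ 2) ≤ v := fun w hw =>
    hγ.offlineValue_le hγlo hS hV hlo hhi hx hw hv
  have hlub := isLUB_csSup ⟨v, hmem⟩
    ⟨v + (S.Pmax * S.τ) ^ 2 / (2 * V * S.ηd ^ 2), fun w hw => by linarith [hle w hw]⟩
  refine ⟨sSup (S.offlineValues μ γ), v, hlub, hon, ?_, hlub.1 hmem⟩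
  rw [sub_le_iff_le_add]
  exact hlub.2 fun w hw => by linarith [hle w hw]
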